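/- Let $k$ be an algebraically closed field in which $2$ is invertible, let $\ell\ge 1$, let $M$ be a $k$-vector space of dimension $2\ell+1$, and put $n=2^{\ell}$. Let $Q$ be the affine space (over $k$) of quadratic forms on $M$. For $q\in Q$ let $\mathrm{C}\ell_q$ be its Clifford algebra and $\mathrm{C}\ell^+_q$ the even part of $\mathrm{C}\ell_q$. A $k$-algebra $A_0$ of dimension $n^2$ (associative, with $1$) is a *specialisation of the matrix algebra $\mathcal M_n$* if there are a discrete valuation ring $R$ over $k$ with residue field $k$ and fraction field $K$, and an $R$-algebra $A$, free as an $R$-module, such that $A\otimes_R\overline K\simeq \mathcal M_n(\overline K)$ and $A\otimes_R k\simeq A_0$ as algebras. Let $V=\Lambda^{+}M$ be the even part of the exterior algebra of $M$ (so $\dim V=n^2$), let $e_0=1\in V$, and let $\mathcal A_n$ be the variety, a reduced closed subscheme of the affine space $\operatorname{Hom}(V\otimes V,V)$, of those associative algebra structures on $V$ with identity element $e_0$ which are specialisations of $\mathcal M_n$. Choose, linearly in $q$, a bilinear form $\beta_q$ on $M$ with $\beta_q(x,x)=q(x)$ for all $x$, and identify $V$ with $\mathrm{C}\ell^+_q$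 by the restriction of the linear isomorphism $\lambda_q:\Lambda M\to \mathrm{C}\ell_q$ given by $\lambda_q(1)=1$ and $\lambda_q(a\wedge x)=a\,\lambda_q(x)-\beta_q(a,\cdot)\,\lrcorner\,\lambda_q(x)$ for $a\in M$. (For symmetric $\beta_q$ this is antisymmetrisation; if $\beta_q(e_i,e_j)=0$ for all $i<j$ in a basis $(e_i)$ of $M$, then it sends $e_{i_1}\wedge\dots\wedge e_{i_r}$ to $e_{i_1}\cdots e_{i_r}$ for $i_1<\dots<i_r$.) Let $\theta(q)$ be the algebra structure on $V$ obtained from $\mathrm{C}\ell^+_q$ in this way. Then $\theta(q)$ is a specialisation of $\mathcal M_n$ for every $q$, and $q\mapsto\theta(q)$ is a morphism of $k$-schemes $\theta:Q\to\mathcal A_n$ which is a closed embedding (closed immersion). -/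

import Mathlib

open CategoryTheory AlgebraicGeometry
open scoped TensorProduct

universe u

namespace CliffordSpecialisation

noncomputable section

/-! ### Affine spaces and their reduced closed subschemes -/

section AffineSpace

variable (k : Type u) [Field k] (W : Type u) [AddCommGroup W] [Module k W]

/-- The ring of polynomial functions on the vector space `W`: the symmetric algebra of its dual. -/
abbrev CoordRing : Type u := SymmetricAlgebra k (Module.Dual k W)

/-- The affine space of the (finite dimensional) vector space `W`, as a scheme. -/
abbrev affineSpace : Scheme.{u} := Spec (.of (CoordRing k W))

/-- The structure morphism of the affine space of `W` to `Spec k`. -/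
def affineSpaceStr : affineSpace k W ⟶ Spec (.of k) :=
  Spec.map (CommRingCat.ofHom (algebraMap k (CoordRing k W)))

variable {W}

/-- Evaluation of polynomial functions at the vector `w`. -/
def evalAt (w : W) : CoordRing k W →ₐ[k] k :=
  SymmetricAlgebra.lift (Module.Dual.eval k W w)

/-- The `k`-rational point of the affine space of `W` given by the vector `w`. -/
def point (w : W) : Spec (.of k) ⟶ affineSpace k W :=
  Spec.map (CommRingCat.ofHom (evalAt k w).toRingHom)

/-- The ideal of all polynomial functions that vanish on the set `S` of vectors. -/
def vanishingIdeal (S : Set W) : Ideal (CoordRing k W) :=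
  ⨅ w ∈ S, RingHom.ker (evalAt k w)

/-- The reduced closed subscheme of the affine space of `W` that is determined by the set `S` of
`k`-rational points (if `S` is Zariski closed and `k` is algebraically closed, then `S` is its set
of `k`-rational points). -/
abbrev subvariety (S : Set W) : Scheme.{u} := Spec (.of (CoordRing k W ⧸ vanishingIdeal k S))

/-- The inclusion of `subvariety k S` into the affine space. -/
def subvarietyIncl (S : Set W) : subvariety k S ⟶ affineSpace k W :=
  Spec.map (CommRingCat.ofHom (Ideal.Quotient.mk (vanishingIdeal k S)))

end AffineSpace

/-! ### Specialisations of the matrix algebra -/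

section Specialisation

variable (k : Type u) [Field k]

/-- The `k`-algebra `A₀` is a specialisation of the algebra of `n × n` matrices: it has dimension
`n ^ 2`, and there are a discrete valuation ring `R` over `k` with residue field `k` and an
`R`-algebra `A`, free as an `R`-module, whose geometric generic fibre is the matrix algebra and
whose special fibre is `A₀`. -/
def IsSpecialisation (n : ℕ) (A₀ : Type u) [Ring A₀] [Algebra k A₀] : Prop :=
  Module.finrank k A₀ = n ^ 2 ∧
  ∃ (R : Type u) (_ : CommRing R) (_ : IsDomain R) (_ : IsDiscreteValuationRing R)
    (_ : Algebra k R) (A : Type u) (_ : Ring A) (_ : Algebra R A),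
    Function.Bijective (algebraMap k (IsLocalRing.ResidueField R)) ∧
    Module.Free R A ∧
    Nonempty ((AlgebraicClosure (FractionRing R) ⊗[R] A)
      ≃ₐ[AlgebraicClosure (FractionRing R)]
        Matrix (Fin n) (Fin n) (AlgebraicClosure (FractionRing R))) ∧
    Nonempty ((IsLocalRing.ResidueField R ⊗[R] A) ≃ₐ[k] A₀)

/-- The set of those bilinear multiplications on the vector space `V` which make `V` an associative
algebra with identity element `e₀` that is a specialisation of the algebra of `n × n` matrices. -/
def specialisations (n : ℕ) {V : Type u} [AddCommGroup V] [Module k V] (e₀ : V) :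
    Set (V →ₗ[k] V →ₗ[k] V) :=
  {μ | ∃ (A₀ : Type u) (_ : Ring A₀) (_ : Algebra k A₀) (φ : V ≃ₗ[k] A₀),
    φ e₀ = 1 ∧ (∀ x y, φ (μ x y) = φ x * φ y) ∧ IsSpecialisation k n A₀}

/-- The variety `𝒜ₙ` of specialisations of the algebra of `n × n` matrices, as a reduced closed
subscheme of the affine space of bilinear multiplications on `V`. -/
abbrev specialisationVariety (n : ℕ) {V : Type u} [AddCommGroup V] [Module k V] (e₀ : V) :
    Scheme.{u} :=
  subvariety k (specialisations k n e₀)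

end Specialisation

/-! ### The even Clifford algebra as a multiplication on the even exterior algebra -/

section Clifford

variable {k : Type u} [Field k] {M : Type u} [AddCommGroup M] [Module k M]

theorem contractLeft_mem_evenOdd {q : QuadraticForm k M} (d : Module.Dual k M) (i : ZMod 2)
    {x : CliffordAlgebra q} (hx : x ∈ CliffordAlgebra.evenOdd q i) :
    CliffordAlgebra.contractLeft d x ∈ CliffordAlgebra.evenOdd q (i + 1) := by
  induction x, hx using CliffordAlgebra.evenOdd_induction with
  | range_ι_pow v h =>
    fin_cases i
    · obtain ⟨r, rfl⟩ := Submodule.mem_one.mp h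
      rw [CliffordAlgebra.contractLeft_algebraMap]
      exact Submodule.zero_mem _
    · have h' : v ∈ LinearMap.range (CliffordAlgebra.ι q) ^ 1 := h
      rw [pow_one] at h'
      obtain ⟨a, rfl⟩ := h'
      rw [CliffordAlgebra.contractLeft_ι]
      exact SetLike.algebraMap_mem_graded (CliffordAlgebra.evenOdd q) _
  | add x y hx hy ihx ihy =>
    rw [map_add]
    exact Submodule.add_mem _ ihx ihy
  | ι_mul_ι_mul a b x hx ih =>
    rw [mul_assoc, CliffordAlgebra.contractLeft_ι_mul, CliffordAlgebra.contractLeft_ι_mul, mul_sub,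
      mul_smul_comm, ← mul_assoc]
    have hι : ∀ c y, y ∈ CliffordAlgebra.evenOdd q i →
        CliffordAlgebra.ι q c * y ∈ CliffordAlgebra.evenOdd q (i + 1) := fun c y hy =>
      add_comm (1 : ZMod 2) i ▸
        SetLike.mul_mem_graded (CliffordAlgebra.ι_mem_evenOdd_one q c) hy
    refine Submodule.sub_mem _ (Submodule.smul_mem _ _ (hι _ _ hx)) (Submodule.sub_mem _
      (Submodule.smul_mem _ _ (hι _ _ hx)) ?_)
    exact zero_add (i + 1) ▸
      SetLike.mul_mem_graded (CliffordAlgebra.ι_mul_ι_mem_evenOdd_zero q a b) ih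

theorem changeForm_mem_even {q q' : QuadraticForm k M} {B : LinearMap.BilinForm k M}
    (h : B.toQuadraticMap = q' - q) {x : CliffordAlgebra q} (hx : x ∈ CliffordAlgebra.even q) :
    CliffordAlgebra.changeForm h x ∈ CliffordAlgebra.even q' := by
  change x ∈ CliffordAlgebra.evenOdd q 0 at hx
  change _ ∈ CliffordAlgebra.evenOdd q' 0
  induction x, hx using CliffordAlgebra.even_induction with
  | algebraMap r =>
    rw [CliffordAlgebra.changeForm_algebraMap]
    exact SetLike.algebraMap_mem_graded (CliffordAlgebra.evenOdd q') _
  | add x y hx hy ihx ihy =>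
    rw [map_add]
    exact Submodule.add_mem _ ihx ihy
  | ι_mul_ι_mul a b x hx ih =>
    have h1 : CliffordAlgebra.changeForm h (CliffordAlgebra.ι q b * x) ∈
        CliffordAlgebra.evenOdd q' 1 := by
      rw [CliffordAlgebra.changeForm_ι_mul]
      refine Submodule.sub_mem _ ?_ ?_
      · exact add_zero (1 : ZMod 2) ▸
          SetLike.mul_mem_graded (CliffordAlgebra.ι_mem_evenOdd_one q' b) ih
      · exact zero_add (1 : ZMod 2) ▸ contractLeft_mem_evenOdd _ _ ih
    have h11 : (1 : ZMod 2) + 1 = 0 := rfl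
    rw [mul_assoc, CliffordAlgebra.changeForm_ι_mul]
    refine Submodule.sub_mem _ ?_ ?_
    · exact h11 ▸ SetLike.mul_mem_graded (CliffordAlgebra.ι_mem_evenOdd_one q' a) h1
    · exact h11 ▸ contractLeft_mem_evenOdd _ _ h1

variable (k M) in
/-- The even part of the exterior algebra of `M`, as the even Clifford algebra of the zero form
(in Mathlib, `ExteriorAlgebra k M` is by definition the Clifford algebra of the zero form). -/
abbrev EvenExterior : Type u := CliffordAlgebra.even (0 : QuadraticForm k M)

/-- For a bilinear form `B` with `B x x = q x`, the induced isomorphism of vector spaces from the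
even exterior algebra to the even Clifford algebra of `q`. It is the restriction of the isomorphism
`λ` from the exterior algebra to the Clifford algebra with `λ 1 = 1` and
`λ (a ∧ x) = a * λ x - B a ⌋ λ x`. If `B` is symmetric, then `λ` is antisymmetrisation; if
`B (e i) (e j) = 0` for `i < j` in some basis `e`, then `λ` sends every wedge monomial
`e i₁ ∧ ⋯ ∧ e iᵣ` with `i₁ < ⋯ < iᵣ` to the product `e i₁ * ⋯ * e iᵣ`. -/
def evenIso (q : QuadraticForm k M) (B : LinearMap.BilinForm k M) (h : B.toQuadraticMap = q) :
    EvenExterior k M ≃ₗ[k] CliffordAlgebra.even q :=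
  have h' : B.toQuadraticMap = q - 0 := by rw [h, sub_zero]
  { (CliffordAlgebra.changeForm h').restrict
      (p := Subalgebra.toSubmodule (CliffordAlgebra.even (0 : QuadraticForm k M)))
      (q := Subalgebra.toSubmodule (CliffordAlgebra.even q))
      (fun _ hx => changeForm_mem_even h' hx) with
    invFun := fun y => ⟨CliffordAlgebra.changeForm (CliffordAlgebra.changeForm.neg_proof h') y.1,
      changeForm_mem_even _ y.2⟩
    left_inv := fun x => Subtype.ext ((CliffordAlgebra.changeFormEquiv h').left_inv x.1)
    right_inv := fun y => Subtype.ext ((CliffordAlgebra.changeFormEquiv h').right_inv y.1) }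

/-- The multiplication of the even Clifford algebra of `q`, transported to the even exterior
algebra along `evenIso q B h`. -/
def cliffordMul (q : QuadraticForm k M) (B : LinearMap.BilinForm k M) (h : B.toQuadraticMap = q) :
    EvenExterior k M →ₗ[k] EvenExterior k M →ₗ[k] EvenExterior k M :=
  ((LinearMap.mul k (CliffordAlgebra.even q)).compl₁₂
    (evenIso q B h).toLinearMap (evenIso q B h).toLinearMap).compr₂ (evenIso q B h).symm.toLinearMap

end Clifford

end

end CliffordSpecialisation

/-! Specialisation: as `2` is invertible, `q` is diagonal with weights `w i`. Over `k⟦t⟧` take the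
diagonal form with weights `w i + t`. It reduces to `q` at `t = 0`, and no weight vanishes
generically. Even Clifford algebras commute with base change (`evenWeightedSumSquaresBaseChange`),
so the special fibre is the even Clifford algebra of `q`. Over an algebraically closed field a
nondegenerate form of rank `2 ℓ + 1` is equivalent to `Q ⊥ ⟨-1⟩`, with `Q` a sum of `ℓ` hyperbolic
planes. Its even Clifford algebra is the full Clifford algebra of `Q`, and each plane contributes a
factor of `2 × 2` matrices.

Morphism: the recursions for `λ` and its inverse multiply by vectors and contract with `β q a`,
which is linear in `q`. Hence the structure constants are polynomial in `q`
(`isPolynomialMap_cliffordMul`). Since `k` is infinite, polynomials are determined by their values,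
so the map factors through the reduced subscheme.

Closed immersion: in the product of `a ∧ b` and `a ∧ c` the coefficient of `b ∧ c` is `-q a`,
whatever `β` is (`cliffordMul_wedge_wedge`). Thus `q a` is linear in the structure constants. The
evaluations `q ↦ q a` span the dual of the space of forms, so the map of coordinate rings is
surjective. Independent `a`, `b`, `c` exist because `ℓ ≥ 1`. -/

namespace CliffordSpecialisation

noncomputable section

/-! ### Functoriality of the even Clifford algebra -/

section EvenFunctoriality

variable {R : Type*} [CommRing R] {M₁ M₂ : Type*} [AddCommGroup M₁] [Module R M₁]
  [AddCommGroup M₂] [Module R M₂]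

/-- The homomorphism of even Clifford algebras induced by an isometry. -/
def evenMap {Q₁ : QuadraticForm R M₁} {Q₂ : QuadraticForm R M₂} (f : Q₁ →qᵢ Q₂) :
    CliffordAlgebra.even Q₁ →ₐ[R] CliffordAlgebra.even Q₂ :=
  CliffordAlgebra.even.lift Q₁
    { bilin := (CliffordAlgebra.even.ι Q₂).bilin.compl₁₂ f.toLinearMap f.toLinearMap
      contract := fun m => by
        simpa using (CliffordAlgebra.even.ι Q₂).contract (f m)
      contract_mid := fun m₁ m₂ m₃ => by
        simpa using (CliffordAlgebra.even.ι Q₂).contract_mid (f m₁) (f m₂) (f m₃) }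

/-- The isomorphism of even Clifford algebras induced by an equivalence of quadratic forms. -/
def evenEquivOfIsometry {Q₁ : QuadraticForm R M₁} {Q₂ : QuadraticForm R M₂}
    (e : Q₁.IsometryEquiv Q₂) : CliffordAlgebra.even Q₁ ≃ₐ[R] CliffordAlgebra.even Q₂ :=
  AlgEquiv.ofAlgHom (evenMap e.toIsometry) (evenMap e.symm.toIsometry)
    (by
      refine CliffordAlgebra.even.algHom_ext Q₂ ?_
      ext m₁ m₂
      simp [evenMap, CliffordAlgebra.EvenHom.compr₂])
    (by
      refine CliffordAlgebra.even.algHom_ext Q₁ ?_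
      ext m₁ m₂
      simp [evenMap, CliffordAlgebra.EvenHom.compr₂])

/-- The odd part is a complement of the even part. Being a direct summand is what survives base
change. -/
theorem even_exists_retraction (Q : QuadraticForm R M₁) :
    ∃ g : CliffordAlgebra Q →ₗ[R] CliffordAlgebra.even Q,
      ∀ x : CliffordAlgebra.even Q, g x = x :=
  ⟨(CliffordAlgebra.evenOdd Q 0).projectionOnto _ (CliffordAlgebra.evenOdd_isCompl Q),
    fun x => Submodule.projectionOnto_apply_left (CliffordAlgebra.evenOdd_isCompl Q) x⟩

end EvenFunctoriality

/-! ### Base change of even Clifford algebras -/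

section EvenBaseChange

variable {R : Type*} [CommRing R] [Invertible (2 : R)] {M : Type*} [AddCommGroup M] [Module R M]
  (S : Type*) [CommRing S] [Algebra R S] (Q : QuadraticForm R M)

/-- The base change of the even Clifford algebra, mapped to the Clifford algebra of the base change
of the form. -/
def evenBaseChangeHom : S ⊗[R] CliffordAlgebra.even Q →ₐ[S] CliffordAlgebra (Q.baseChange S) :=
  (CliffordAlgebra.ofBaseChange S Q).comp
    (Algebra.TensorProduct.map (AlgHom.id S S) (CliffordAlgebra.even Q).val)

/-- A linear retraction stays one after tensoring, so `S` need not be flat. This matters for the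
residue field. -/
theorem evenBaseChangeHom_injective : Function.Injective (evenBaseChangeHom S Q) := by
  obtain ⟨g, hg⟩ := even_exists_retraction Q
  refine (CliffordAlgebra.equivBaseChange S Q).symm.injective.comp ?_
  refine Function.LeftInverse.injective (g := LinearMap.lTensor S g) fun x => ?_
  induction x with
  | zero => simp
  | add x y hx hy => simp only [map_add, hx, hy]
  | tmul s x => simp [hg]

/-- Products of two vectors generate the even part, and by bilinearity pure tensors suffice. -/
theorem evenBaseChangeHom_range :
    (evenBaseChangeHom S Q).range = CliffordAlgebra.even (Q.baseChange S) := by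
  have hι (a b : S ⊗[R] M) : CliffordAlgebra.ι (Q.baseChange S) a *
      CliffordAlgebra.ι (Q.baseChange S) b ∈ (evenBaseChangeHom S Q).range := by
    induction a with
    | zero => simp
    | add x y hx hy => rw [map_add, add_mul]; exact add_mem hx hy
    | tmul s x =>
      induction b with
      | zero => simp
      | add x y hx hy => rw [map_add, mul_add]; exact add_mem hx hy
      | tmul t y =>
        refine ⟨(s * t) ⊗ₜ (CliffordAlgebra.even.ι Q).bilin x y, ?_⟩
        rw [← CliffordAlgebra.ofBaseChange_tmul_ι, ← CliffordAlgebra.ofBaseChange_tmul_ι, ← map_mul,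
          Algebra.TensorProduct.tmul_mul_tmul]
        rfl
  apply le_antisymm
  · rintro _ ⟨x, rfl⟩
    induction x with
    | zero => simp
    | add x y hx hy => rw [map_add]; exact add_mem hx hy
    | tmul s x =>
      obtain ⟨x, hx⟩ := x
      change s • CliffordAlgebra.ofBaseChangeAux S Q x ∈ CliffordAlgebra.evenOdd (Q.baseChange S) 0
      refine Submodule.smul_mem _ _ ?_
      change x ∈ CliffordAlgebra.evenOdd Q 0 at hx
      induction x, hx using CliffordAlgebra.even_induction with
      | algebraMap r =>
        rw [AlgHom.commutes, IsScalarTower.algebraMap_apply R S]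
        exact SetLike.algebraMap_mem_graded (CliffordAlgebra.evenOdd (Q.baseChange S)) _
      | add x y hx hy ihx ihy => rw [map_add]; exact add_mem ihx ihy
      | ι_mul_ι_mul a b x hx ih =>
        rw [map_mul, map_mul, CliffordAlgebra.ofBaseChangeAux_ι,
          CliffordAlgebra.ofBaseChangeAux_ι]
        exact mul_mem (S := Subalgebra S _) (s := CliffordAlgebra.even (Q.baseChange S))
          (CliffordAlgebra.ι_mul_ι_mem_evenOdd_zero _ _ _) ih
  · intro x hx
    change x ∈ CliffordAlgebra.evenOdd (Q.baseChange S) 0 at hx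
    induction x, hx using CliffordAlgebra.even_induction with
    | algebraMap r => exact algebraMap_mem _ r
    | add x y hx hy ihx ihy => exact add_mem ihx ihy
    | ι_mul_ι_mul a b x hx ih => exact mul_mem (hι a b) ih

/-- The even Clifford algebra commutes with base change. -/
def evenBaseChange :
    S ⊗[R] CliffordAlgebra.even Q ≃ₐ[S] CliffordAlgebra.even (Q.baseChange S) :=
  (AlgEquiv.ofInjective _ (evenBaseChangeHom_injective S Q)).trans
    (Subalgebra.equivOfEq _ _ (evenBaseChangeHom_range S Q))

variable {ι : Type*} [Fintype ι] [DecidableEq ι]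

/-- The base change of a diagonal quadratic form is the diagonal form with the same weights. -/
def weightedSumSquaresBaseChange (w : ι → R) :
    (QuadraticForm.baseChange S (QuadraticMap.weightedSumSquares R w)).IsometryEquiv
      (QuadraticMap.weightedSumSquares S fun i => algebraMap R S (w i)) where
  toLinearEquiv := TensorProduct.piScalarRight R S S ι
  map_app' := by
    have : (QuadraticMap.weightedSumSquares S fun i => algebraMap R S (w i)).comp
        (TensorProduct.piScalarRight R S S ι).toLinearMap =
        QuadraticForm.baseChange S (QuadraticMap.weightedSumSquares R w) := by
      refine baseChange_ext fun m => ?_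
      simp [QuadraticForm.baseChange_tmul, QuadraticMap.weightedSumSquares_apply,
        Algebra.smul_def]
    exact fun m => DFunLike.congr_fun this m

/-- The even Clifford algebra of a diagonal form commutes with base change. -/
def evenWeightedSumSquaresBaseChange (w : ι → R) :
    S ⊗[R] CliffordAlgebra.even (QuadraticMap.weightedSumSquares R w) ≃ₐ[S]
      CliffordAlgebra.even (QuadraticMap.weightedSumSquares S fun i => algebraMap R S (w i)) :=
  (evenBaseChange S _).trans (evenEquivOfIsometry (weightedSumSquaresBaseChange S w))

end EvenBaseChange

/-! ### Freeness of the Clifford algebra and of its even part -/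

section Rank

variable {R : Type*} [CommRing R] [Invertible (2 : R)] {M : Type*} [AddCommGroup M] [Module R M]
  {n : ℕ} (b : Module.Basis (Fin n) R M) (Q : QuadraticForm R M)

/-- A basis of the Clifford algebra that is indexed by the sets of basis vectors. -/
def cliffordBasis : Module.Basis (Finset (Fin n)) R (CliffordAlgebra Q) :=
  b.ExteriorAlgebra.map (CliffordAlgebra.equivExterior Q).symm

/-- A submodule of a free module of finite rank over a principal ideal domain is free. -/
theorem free_even {R : Type*} [CommRing R] [Invertible (2 : R)] [IsDomain R]
    [IsPrincipalIdealRing R] {M : Type*} [AddCommGroup M] [Module R M] {n : ℕ}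
    (b : Module.Basis (Fin n) R M) (Q : QuadraticForm R M) :
    Module.Free R (CliffordAlgebra.even Q) :=
  .of_basis ((CliffordAlgebra.evenOdd Q 0).basisOfPid (cliffordBasis b Q)).2

end Rank

/-! ### Clifford algebras that are matrix algebras -/

section MatrixAlgebra

variable {F : Type u} [Field F] {E : Type u} [AddCommGroup E] [Module F E]

/-- The hyperbolic plane. -/
def hyperbolicPlane (F : Type u) [Field F] : QuadraticForm F (F × F) :=
  QuadraticMap.linMulLin (LinearMap.fst F F F) (LinearMap.snd F F F)

/-- The Clifford algebra of the orthogonal sum of `Q` and a hyperbolic plane, represented by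
`2 × 2` matrices over the Clifford algebra of `Q`. -/
def cliffordProdHyperbolicHom (Q : QuadraticForm F E) :
    CliffordAlgebra (Q.prod (hyperbolicPlane F)) →ₐ[F]
      Matrix (Fin 2) (Fin 2) (CliffordAlgebra Q) :=
  CliffordAlgebra.lift _
    ⟨{ toFun := fun v => !![CliffordAlgebra.ι Q v.1, algebraMap F _ v.2.1;
          algebraMap F _ v.2.2, -CliffordAlgebra.ι Q v.1]
       map_add' := fun v w => by
        ext i j
        fin_cases i <;> fin_cases j <;> simp [add_comm]
       map_smul' := fun r v => by
        ext i j
        fin_cases i <;> fin_cases j <;> simp [Algebra.smul_def] },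
     fun v => by
      ext i j
      fin_cases i <;> fin_cases j <;>
        simp [Matrix.mul_apply, hyperbolicPlane, Algebra.algebraMap_eq_smul_one,
          add_smul, mul_smul]
      · exact smul_comm _ _ _
      · exact add_comm _ _⟩

theorem cliffordProdHyperbolicHom_ι (Q : QuadraticForm F E) (v : E × F × F) :
    cliffordProdHyperbolicHom Q (CliffordAlgebra.ι _ v) =
      !![CliffordAlgebra.ι Q v.1, algebraMap F _ v.2.1;
        algebraMap F _ v.2.2, -CliffordAlgebra.ι Q v.1] :=
  CliffordAlgebra.lift_ι_apply _ _ _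

/-- The isotropic vectors of the plane give the off-diagonal matrix units, whose products are the
diagonal ones. It remains to reach the matrices `diag(c, c)`. -/
theorem cliffordProdHyperbolicHom_surjective (Q : QuadraticForm F E) :
    Function.Surjective (cliffordProdHyperbolicHom Q) := by
  rw [← AlgHom.range_eq_top, eq_top_iff]
  set A := (cliffordProdHyperbolicHom Q).range
  have hX : !![0, 1; 0, 0] ∈ A :=
    ⟨CliffordAlgebra.ι _ (0, 1, 0), by simp [cliffordProdHyperbolicHom_ι]⟩
  have hY : !![0, 0; 1, 0] ∈ A :=
    ⟨CliffordAlgebra.ι _ (0, 0, 1), by simp [cliffordProdHyperbolicHom_ι]⟩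
  have hD (c : CliffordAlgebra Q) : !![c, 0; 0, c] ∈ A := by
    induction c using CliffordAlgebra.induction with
    | algebraMap r =>
      convert algebraMap_mem A r using 1
      ext i j
      fin_cases i <;> fin_cases j <;> simp [Matrix.algebraMap_matrix_apply]
    | ι v =>
      have hv : !![CliffordAlgebra.ι Q v, 0; 0, -CliffordAlgebra.ι Q v] ∈ A :=
        ⟨CliffordAlgebra.ι _ (v, 0, 0), by simp [cliffordProdHyperbolicHom_ι]⟩
      -- The commutator of the two off-diagonal units is `diag(1, -1)`, which corrects the sign in
      -- `diag(v, -v)`.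
      convert mul_mem hv (sub_mem (mul_mem hX hY) (mul_mem hY hX)) using 1
      simp
    | mul a b ha hb =>
      convert mul_mem ha hb using 1
      simp
    | add a b ha hb =>
      convert add_mem ha hb using 1
      simp
  intro m _
  convert add_mem (add_mem (mul_mem (hD (m 0 0)) (mul_mem hX hY)) (mul_mem (hD (m 0 1)) hX))
    (add_mem (mul_mem (hD (m 1 0)) hY) (mul_mem (hD (m 1 1)) (mul_mem hY hX))) using 1
  ext i j
  fin_cases i <;> fin_cases j <;> simp

theorem finrank_clifford (h2 : (2 : F) ≠ 0) [Module.Finite F E] (Q : QuadraticForm F E) :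
    Module.finrank F (CliffordAlgebra Q) = 2 ^ Module.finrank F E := by
  have := invertibleOfNonzero h2
  rw [Module.finrank_eq_card_basis (cliffordBasis (Module.finBasis F E) Q)]
  simp

theorem finite_clifford (h2 : (2 : F) ≠ 0) [Module.Finite F E] (Q : QuadraticForm F E) :
    Module.Finite F (CliffordAlgebra Q) :=
  have := invertibleOfNonzero h2
  .of_basis (cliffordBasis (Module.finBasis F E) Q)

/-- The Clifford algebra of the orthogonal sum of `Q` and a hyperbolic plane is the algebra of
`2 × 2` matrices over the Clifford algebra of `Q`. -/
def cliffordProdHyperbolicEquiv (h2 : (2 : F) ≠ 0) [Module.Finite F E] (Q : QuadraticForm F E) :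
    CliffordAlgebra (Q.prod (hyperbolicPlane F)) ≃ₐ[F]
      Matrix (Fin 2) (Fin 2) (CliffordAlgebra Q) :=
  AlgEquiv.ofBijective (cliffordProdHyperbolicHom Q) <| by
    have := finite_clifford h2 Q
    have := finite_clifford h2 (Q.prod (hyperbolicPlane F))
    have h : Module.finrank F (CliffordAlgebra (Q.prod (hyperbolicPlane F))) =
        Module.finrank F (Matrix (Fin 2) (Fin 2) (CliffordAlgebra Q)) := by
      rw [Module.finrank_matrix, finrank_clifford h2, finrank_clifford h2]
      simp [pow_add]
      ring
    exact ⟨(LinearMap.injective_iff_surjective_of_finrank_eq_finrank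
      (f := (cliffordProdHyperbolicHom Q).toLinearMap) h).2
      (cliffordProdHyperbolicHom_surjective Q), cliffordProdHyperbolicHom_surjective Q⟩

theorem nonempty_algEquiv_of_finrank_eq_one {A B : Type u} [Ring A] [Algebra F A] [Ring B]
    [Algebra F B] (hA : Module.finrank F A = 1) (hB : Module.finrank F B = 1) :
    Nonempty (A ≃ₐ[F] B) := by
  have key {C : Type u} [Ring C] [Algebra F C] (hC : Module.finrank F C = 1) :
      Function.Bijective (Algebra.ofId F C) := by
    have : Nontrivial C := Module.nontrivial_of_finrank_pos (R := F) (by omega)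
    have : Module.Finite F C := Module.finite_of_finrank_pos (by omega)
    have hi : Function.Injective (Algebra.ofId F C) := (algebraMap F C).injective
    exact ⟨hi, (LinearMap.injective_iff_surjective_of_finrank_eq_finrank
      (f := (Algebra.ofId F C).toLinearMap) (by simp [hC])).1 hi⟩
  exact ⟨(AlgEquiv.ofBijective _ (key hA)).symm.trans (AlgEquiv.ofBijective _ (key hB))⟩

/-- There is a nondegenerate form of rank `2 ℓ` whose Clifford algebra is a matrix algebra. -/
theorem exists_clifford_equiv_matrix (F : Type u) [Field F] (h2 : (2 : F) ≠ 0) (ℓ : ℕ) :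
    ∃ (E : Type u) (_ : AddCommGroup E) (_ : Module F E) (_ : Module.Finite F E)
      (Q : QuadraticForm F E), Module.finrank F E = 2 * ℓ ∧
      Q.polarBilin.SeparatingLeft ∧
      Nonempty (CliffordAlgebra Q ≃ₐ[F] Matrix (Fin (2 ^ ℓ)) (Fin (2 ^ ℓ)) F) := by
  induction ℓ with
  | zero =>
    refine ⟨Fin 0 → F, inferInstance, inferInstance, inferInstance, 0, by simp,
      fun x _ => Subsingleton.elim _ _, ?_⟩
    exact nonempty_algEquiv_of_finrank_eq_one (by simp [finrank_clifford h2])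
      (by simp [Module.finrank_matrix])
  | succ ℓ ih =>
    obtain ⟨E, _, _, _, Q, hE, hQ, ⟨e⟩⟩ := ih
    refine ⟨E × F × F, inferInstance, inferInstance, inferInstance, Q.prod (hyperbolicPlane F),
      by simp [hE]; ring, fun x hx => ?_, ?_⟩
    · have h1 : x.1 = 0 := hQ _ fun y => by simpa [QuadraticMap.polar] using hx (y, 0)
      have h2 : x.2.1 = 0 := by
        simpa [QuadraticMap.polar, hyperbolicPlane, mul_add] using hx (0, 0, 1)
      have h3 : x.2.2 = 0 := by
        simpa [QuadraticMap.polar, hyperbolicPlane, add_mul] using hx (0, 1, 0)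
      exact Prod.ext h1 (Prod.ext h2 h3)
    · exact ⟨(cliffordProdHyperbolicEquiv h2 Q).trans <| e.mapMatrix.trans <|
        (Matrix.compAlgEquiv _ _ _ _).trans <| Matrix.reindexAlgEquiv _ _ <|
        finProdFinEquiv.trans <| finCongr (by rw [pow_succ, mul_comm])⟩

theorem separatingLeft_associated [Invertible (2 : F)] {Q : QuadraticForm F E}
    (hQ : Q.polarBilin.SeparatingLeft) : (QuadraticMap.associated Q).SeparatingLeft := by
  intro x hx
  refine hQ x fun y => ?_
  rw [← QuadraticMap.two_nsmul_associated F, LinearMap.smul_apply, LinearMap.smul_apply]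
  exact (congrArg _ (hx y)).trans (smul_zero _)

/-- Over an algebraically closed field, the even Clifford algebra of a nondegenerate diagonal form
of odd rank is a matrix algebra. -/
theorem nonempty_even_weightedSumSquares_equiv_matrix [IsAlgClosed F] (h2 : (2 : F) ≠ 0) {ℓ : ℕ}
    (w : Fin (2 * ℓ + 1) → F) (hw : ∀ i, w i ≠ 0) :
    Nonempty (CliffordAlgebra.even (QuadraticMap.weightedSumSquares F w) ≃ₐ[F]
      Matrix (Fin (2 ^ ℓ)) (Fin (2 ^ ℓ)) F) := by
  classical
  have := invertibleOfNonzero h2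
  obtain ⟨E, _, _, _, Q, hE, hQ, ⟨e⟩⟩ := exists_clifford_equiv_matrix F h2 ℓ
  have hE' : Module.finrank F (E × F) = 2 * ℓ + 1 := by simp [hE]
  -- `Q'` is `Q ⊥ ⟨-1⟩`, whose even Clifford algebra is the full Clifford algebra of `Q`. It is
  -- nondegenerate of rank `2 ℓ + 1`, hence equivalent to the given diagonal form.
  have hQ' : (CliffordAlgebra.EquivEven.Q' Q).polarBilin.SeparatingLeft := by
    intro x hx
    have h1 : x.1 = 0 := hQ _ fun y => by simpa [QuadraticMap.polar] using hx (y, 0)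
    have h3 : x.2 = 0 := by
      have := hx (0, 1)
      simp [QuadraticMap.polar] at this
      have h' : 2 * x.2 = 0 := by linear_combination -this
      simpa [h2] using h'
    exact Prod.ext h1 h3
  obtain ⟨f⟩ := QuadraticForm.equivalent_weightedSumSquares_of_isAlgClosed _
    (separatingLeft_associated hQ')
  rw [hE'] at f
  have g := QuadraticForm.isometryEquivSumSquaresUnits fun i => Units.mk0 (w i) (hw i)
  exact ⟨(evenEquivOfIsometry (g.trans f.symm)).trans
    ((CliffordAlgebra.equivEven Q).symm.trans e)⟩

end MatrixAlgebra

/-! ### Even Clifford algebras as specialisations of the matrix algebra -/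

section SpecialisationOfEven

variable {k : Type u} [Field k] {M : Type u} [AddCommGroup M] [Module k M]

/-- In characteristic other than `2`, the even Clifford algebras of all forms on `M` are isomorphic
as vector spaces. -/
theorem nonempty_even_linearEquiv (h2 : (2 : k) ≠ 0) (q q' : QuadraticForm k M) :
    Nonempty (CliffordAlgebra.even q ≃ₗ[k] CliffordAlgebra.even q') := by
  have := invertibleOfNonzero h2
  exact ⟨(evenIso q (QuadraticMap.associated q)
    (QuadraticMap.toQuadraticMap_associated k q)).symm.trans (evenIso q' (QuadraticMap.associated q')
      (QuadraticMap.toQuadraticMap_associated k q'))⟩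

/-- The dimension does not depend on the form, so it may be read off from the sum of squares, where
the algebra is a matrix algebra. -/
theorem finrank_even_weightedSumSquares [IsAlgClosed k] (h2 : (2 : k) ≠ 0) {ℓ : ℕ}
    (w : Fin (2 * ℓ + 1) → k) :
    Module.finrank k (CliffordAlgebra.even (QuadraticMap.weightedSumSquares k w)) =
      (2 ^ ℓ) ^ 2 := by
  obtain ⟨e⟩ := nonempty_even_linearEquiv h2 (QuadraticMap.weightedSumSquares k w)
    (QuadraticMap.weightedSumSquares k (1 : Fin (2 * ℓ + 1) → k))
  obtain ⟨f⟩ := nonempty_even_weightedSumSquares_equiv_matrix h2 (1 : Fin (2 * ℓ + 1) → k)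
    fun _ => one_ne_zero
  rw [(e.trans f.toLinearEquiv).finrank_eq, Module.finrank_matrix]
  simp [sq]

theorem IsSpecialisation.congr {n : ℕ} {A B : Type u} [Ring A] [Algebra k A] [Ring B] [Algebra k B]
    (e : A ≃ₐ[k] B) (h : IsSpecialisation k n A) : IsSpecialisation k n B := by
  obtain ⟨hn, R, _, _, _, _, C, _, _, h1, h2, h3, ⟨f⟩⟩ := h
  exact ⟨e.toLinearEquiv.finrank_eq ▸ hn, R, inferInstance, inferInstance, inferInstance,
    inferInstance, C, inferInstance, inferInstance, h1, h2, h3, ⟨f.trans e⟩⟩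

theorem bijective_algebraMap_residueField_powerSeries :
    Function.Bijective (algebraMap k (IsLocalRing.ResidueField (PowerSeries k))) := by
  refine ⟨RingHom.injective (algebraMap k (IsLocalRing.ResidueField (PowerSeries k))), fun y => ?_⟩
  obtain ⟨f, rfl⟩ := IsLocalRing.residue_surjective y
  refine ⟨PowerSeries.constantCoeff f, ?_⟩
  rw [IsScalarTower.algebraMap_apply k (PowerSeries k)]
  change IsLocalRing.residue _ _ = _
  rw [← sub_eq_zero, ← map_sub, IsLocalRing.residue_eq_zero_iff,
    ← PowerSeries.ker_coeff_eq_max_ideal]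
  simp [RingHom.mem_ker]

theorem isSpecialisation_even_weightedSumSquares [IsAlgClosed k] (h2 : (2 : k) ≠ 0) {ℓ : ℕ}
    (w : Fin (2 * ℓ + 1) → k) :
    IsSpecialisation k (2 ^ ℓ)
      (CliffordAlgebra.even (QuadraticMap.weightedSumSquares k w)) := by
  have : Invertible (2 : k) := invertibleOfNonzero h2
  have : Invertible (2 : PowerSeries k) :=
    (Invertible.map (algebraMap k (PowerSeries k)) 2).copy 2 (map_ofNat _ _).symm
  -- Adding the uniformiser makes every weight nonzero, even where `w i = 0`, without changing the
  -- residues.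
  let W : Fin (2 * ℓ + 1) → PowerSeries k := fun i => PowerSeries.C (w i) + PowerSeries.X
  have hW (i) : W i ≠ 0 := fun h => by
    have := congrArg (PowerSeries.coeff 1) h
    simp [W] at this
  let L := AlgebraicClosure (FractionRing (PowerSeries k))
  let κ := IsLocalRing.ResidueField (PowerSeries k)
  have hL : Function.Injective (algebraMap (PowerSeries k) L) := by
    rw [IsScalarTower.algebraMap_eq (PowerSeries k) (FractionRing (PowerSeries k)) L]
    exact (algebraMap (FractionRing (PowerSeries k)) L).injective.comp
      (IsFractionRing.injective (PowerSeries k) (FractionRing (PowerSeries k)))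
  have h2L : (2 : L) ≠ 0 := by
    rw [← map_ofNat (algebraMap (PowerSeries k) L) 2, map_ne_zero_iff _ hL]
    exact Invertible.ne_zero 2
  refine ⟨finrank_even_weightedSumSquares h2 w, PowerSeries k, inferInstance, inferInstance,
    inferInstance, inferInstance,
    CliffordAlgebra.even (QuadraticMap.weightedSumSquares (PowerSeries k) W), inferInstance,
    inferInstance, bijective_algebraMap_residueField_powerSeries,
    free_even (Pi.basisFun _ _) _, ?_, ?_⟩
  · obtain ⟨e⟩ := nonempty_even_weightedSumSquares_equiv_matrix h2L
      (fun i => algebraMap (PowerSeries k) L (W i)) fun i => (map_ne_zero_iff _ hL).2 (hW i)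
    exact ⟨(evenWeightedSumSquaresBaseChange L W).trans e⟩
  · have hκ : (fun i => algebraMap (PowerSeries k) κ (W i)) = fun i => algebraMap k κ (w i) := by
      funext i
      rw [IsScalarTower.algebraMap_apply k (PowerSeries k) κ]
      change IsLocalRing.residue _ _ = IsLocalRing.residue _ _
      rw [← sub_eq_zero, ← map_sub, IsLocalRing.residue_eq_zero_iff,
        ← PowerSeries.ker_coeff_eq_max_ideal]
      simp [RingHom.mem_ker, W]
    -- Over `κ` the forms coming from `W` and from `w` have the same weights; the base change from
    -- `k` to `κ` is then undone using `k ≃ κ`.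
    have e₁ := evenWeightedSumSquaresBaseChange κ W
    rw [hκ] at e₁
    have e₂ := e₁.trans (evenWeightedSumSquaresBaseChange κ w).symm
    let f : k ≃ₐ[k] κ := AlgEquiv.ofBijective (Algebra.ofId k κ)
      bijective_algebraMap_residueField_powerSeries
    have e₃ := Algebra.TensorProduct.congr f.symm
      (AlgEquiv.refl (R := k) (A₁ := CliffordAlgebra.even (QuadraticMap.weightedSumSquares k w)))
    exact ⟨((e₂.restrictScalars k).trans e₃).trans (Algebra.TensorProduct.lid k _)⟩

theorem isSpecialisation_even [IsAlgClosed k] (h2 : (2 : k) ≠ 0) {ℓ : ℕ}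
    (hM : Module.finrank k M = 2 * ℓ + 1) (q : QuadraticForm k M) :
    IsSpecialisation k (2 ^ ℓ) (CliffordAlgebra.even q) := by
  have : Invertible (2 : k) := invertibleOfNonzero h2
  have : Module.Finite k M := Module.finite_of_finrank_pos (by omega)
  have hq := QuadraticForm.equivalent_weightedSumSquares q
  rw [hM] at hq
  obtain ⟨w, ⟨e⟩⟩ := hq
  exact (isSpecialisation_even_weightedSumSquares h2 w).congr (evenEquivOfIsometry e).symm

theorem evenIso_one (q : QuadraticForm k M) (B : LinearMap.BilinForm k M)
    (h : B.toQuadraticMap = q) : evenIso q B h 1 = 1 :=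
  Subtype.ext (CliffordAlgebra.changeForm_one (by rw [h, sub_zero]))

theorem evenIso_cliffordMul (q : QuadraticForm k M) (B : LinearMap.BilinForm k M)
    (h : B.toQuadraticMap = q) (x y : EvenExterior k M) :
    evenIso q B h (cliffordMul q B h x y) = evenIso q B h x * evenIso q B h y := by
  simp [cliffordMul]

theorem cliffordMul_mem_specialisations [IsAlgClosed k] (h2 : (2 : k) ≠ 0) {ℓ : ℕ}
    (hM : Module.finrank k M = 2 * ℓ + 1) (q : QuadraticForm k M) (B : LinearMap.BilinForm k M)
    (h : B.toQuadraticMap = q) :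
    cliffordMul q B h ∈ specialisations k (2 ^ ℓ) (1 : EvenExterior k M) :=
  ⟨CliffordAlgebra.even q, inferInstance, inferInstance, evenIso q B h, evenIso_one q B h,
    evenIso_cliffordMul q B h, isSpecialisation_even h2 hM q⟩

end SpecialisationOfEven

/-! ### Polynomial maps between vector spaces -/

section PolynomialMap

variable {k : Type u} [Field k] {P : Type u} [AddCommGroup P] [Module k P]
  {N : Type*} [AddCommGroup N] [Module k N] {N₂ : Type*} [AddCommGroup N₂] [Module k N₂]

/-- Polynomial maps from the vector space `P` to the vector space `N`. -/
inductive IsPolynomialMap : (P → N) → Prop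
  | const (n : N) : IsPolynomialMap fun _ => n
  | add {f g : P → N} : IsPolynomialMap f → IsPolynomialMap g → IsPolynomialMap fun p => f p + g p
  | dual_smul (d : Module.Dual k P) {f : P → N} :
      IsPolynomialMap f → IsPolynomialMap fun p => d p • f p

namespace IsPolynomialMap

theorem sum {ι : Type*} (s : Finset ι) {f : ι → P → N}
    (h : ∀ i, IsPolynomialMap (k := k) (f i)) :
    IsPolynomialMap (k := k) fun p => ∑ i ∈ s, f i p := by
  classical
  induction s using Finset.induction_on with
  | empty => simpa using const 0
  | insert i s hi ih => simpa [Finset.sum_insert hi] using (h i).add ih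

theorem map {f : P → N} (hf : IsPolynomialMap (k := k) f) (L : N →ₗ[k] N₂) :
    IsPolynomialMap (k := k) fun p => L (f p) := by
  induction hf with
  | const n => exact const _
  | add _ _ hf hg => simpa only [map_add] using hf.add hg
  | dual_smul d _ hf => simpa only [map_smul] using hf.dual_smul d

theorem smul {c : P → k} {f : P → N} (hc : IsPolynomialMap (k := k) c)
    (hf : IsPolynomialMap (k := k) f) : IsPolynomialMap (k := k) fun p => c p • f p := by
  induction hc with
  | const c => exact hf.map (c • LinearMap.id)
  | add _ _ h₁ h₂ => simpa only [add_smul] using h₁.add h₂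
  | dual_smul d _ h => simpa only [smul_assoc] using h.dual_smul d

theorem linear [Module.Finite k P] (L : P →ₗ[k] N) : IsPolynomialMap (k := k) fun p => L p := by
  let b := Module.finBasis k P
  have h : (fun p => L p) = fun p => ∑ i, b.coord i p • L (b i) := by
    funext p
    conv_lhs => rw [← b.sum_repr p, map_sum]
    simp only [map_smul, Module.Basis.coord_apply]
  rw [h]
  exact sum _ fun i => (const _).dual_smul _

theorem bilinear [Module.Finite k P] {f : P → N} (hf : IsPolynomialMap (k := k) f)
    (L : P →ₗ[k] N →ₗ[k] N₂) : IsPolynomialMap (k := k) fun p => L p (f p) := by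
  induction hf with
  | const n => exact linear (L.flip n)
  | add _ _ hf hg => simpa only [map_add] using hf.add hg
  | dual_smul d _ hf => simpa only [map_smul] using hf.dual_smul d

theorem exists_evalAt_eq {f : P → k} (hf : IsPolynomialMap (k := k) f) :
    ∃ F : CoordRing k P, ∀ p, evalAt k p F = f p := by
  induction hf with
  | const c => exact ⟨algebraMap k _ c, fun p => by simp⟩
  | add _ _ hf hg =>
    obtain ⟨F, hF⟩ := hf
    obtain ⟨G, hG⟩ := hg
    exact ⟨F + G, fun p => by rw [map_add, hF, hG]⟩
  | dual_smul d _ hf =>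
    obtain ⟨F, hF⟩ := hf
    refine ⟨SymmetricAlgebra.ι k _ d * F, fun p => ?_⟩
    rw [map_mul, hF, evalAt, SymmetricAlgebra.lift_ι_apply]
    rfl

/-- A map into a space of bilinear maps on a finite dimensional space is polynomial if its values on
pairs of vectors are. -/
theorem of_apply_apply {V : Type*} [AddCommGroup V] [Module k V] [Module.Finite k V]
    {m : P → V →ₗ[k] V →ₗ[k] N} (h : ∀ x y, IsPolynomialMap (k := k) fun p => m p x y) :
    IsPolynomialMap (k := k) m := by
  let b := Module.finBasis k V
  have hm : m = fun p => ∑ i, ∑ j, (LinearMap.smulRightₗ (b.coord i) ∘ₗ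
      LinearMap.smulRightₗ (b.coord j)) (m p (b i) (b j)) := by
    funext p
    refine b.ext fun i => b.ext fun j => ?_
    simp [LinearMap.sum_apply, Finsupp.single_apply]
  rw [hm]
  exact sum _ fun i => sum _ fun j => (h (b i) (b j)).map _

end IsPolynomialMap

end PolynomialMap

/-! ### Coordinate rings, and a criterion for closed immersions -/

section CoordRing

variable {k : Type u} [Field k] {P W : Type u} [AddCommGroup P] [Module k P] [AddCommGroup W]
  [Module k W]

theorem evalAt_ι (p : P) (d : Module.Dual k P) :
    evalAt k p (SymmetricAlgebra.ι k _ d) = d p :=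
  SymmetricAlgebra.lift_ι_apply _ _

/-- In coordinates, this is the fact that a polynomial over an infinite field is determined by its
values. -/
theorem coordRing_ext [Infinite k] [Module.Finite k P] {F G : CoordRing k P}
    (h : ∀ p, evalAt k p F = evalAt k p G) : F = G := by
  let b := Module.finBasis k P
  let e := SymmetricAlgebra.equivMvPolynomial b.dualBasis
  have he (p : P) : evalAt k p = (MvPolynomial.aeval fun i => b.coord i p).comp e.toAlgHom := by
    refine SymmetricAlgebra.algHom_ext (b.dualBasis.ext fun i => ?_)
    have hi : e (SymmetricAlgebra.ι k _ (b.dualBasis i)) = MvPolynomial.X i :=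
      SymmetricAlgebra.equivMvPolynomial_ι_apply _ _
    change evalAt k p (SymmetricAlgebra.ι k _ (b.dualBasis i)) =
      MvPolynomial.aeval _ (e (SymmetricAlgebra.ι k _ (b.dualBasis i)))
    rw [evalAt_ι, hi, MvPolynomial.aeval_X, b.coe_dualBasis]
  refine e.injective (MvPolynomial.funext fun x => ?_)
  have := h (b.equivFun.symm x)
  rw [he] at this
  simpa [MvPolynomial.aeval_eq_eval, Finsupp.single_apply] using this

/-- The homomorphism of coordinate rings that belongs to a polynomial map. -/
theorem IsPolynomialMap.exists_comap {m : P → W} (hm : IsPolynomialMap (k := k) m) :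
    ∃ Φ : CoordRing k W →ₐ[k] CoordRing k P, ∀ p F, evalAt k p (Φ F) = evalAt k (m p) F := by
  choose G hG using fun ξ : Module.Dual k W => (hm.map ξ).exists_evalAt_eq
  -- The chosen `G` need not be linear in the functional, so only its values on a basis are used and
  -- extended linearly.
  let b := Module.Basis.ofVectorSpace k (Module.Dual k W)
  refine ⟨SymmetricAlgebra.lift (b.constr k fun i => G (b i)), fun p => ?_⟩
  suffices h : (evalAt k p).comp (SymmetricAlgebra.lift (b.constr k fun i => G (b i))) =
      evalAt k (m p) from DFunLike.congr_fun h
  refine SymmetricAlgebra.algHom_ext (b.ext fun i => ?_)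
  simp [hG, evalAt_ι]

/-- A polynomial map from `P` to `W` with values in `S`, from whose coordinates all linear
functionals on `P` can be recovered linearly, is a closed immersion. -/
theorem IsPolynomialMap.exists_isClosedImmersion [Infinite k] [Module.Finite k P] {m : P → W}
    (hm : IsPolynomialMap (k := k) m) {S : Set W} (hS : ∀ p, m p ∈ S)
    (hd : ∀ d : Module.Dual k P, ∃ ξ : Module.Dual k W, ∀ p, ξ (m p) = d p) :
    ∃ θ : affineSpace k P ⟶ subvariety k S,
      θ ≫ subvarietyIncl k S ≫ affineSpaceStr k W = affineSpaceStr k P ∧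
      (∀ p, point k p ≫ θ ≫ subvarietyIncl k S = point k (m p)) ∧
      IsClosedImmersion θ := by
  obtain ⟨Φ, hΦ⟩ := hm.exists_comap
  -- Factoring through the reduced subscheme only needs the pullback of `F` to vanish at each
  -- rational point.
  have hker : ∀ F ∈ vanishingIdeal k S, Φ F = 0 := fun F hF => coordRing_ext fun p => by
    simp only [vanishingIdeal, Submodule.mem_iInf] at hF
    rw [hΦ, map_zero]
    exact hF _ (hS p)
  let Ψ : CoordRing k W ⧸ vanishingIdeal k S →+* CoordRing k P :=
    Ideal.Quotient.lift _ Φ.toRingHom hker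
  refine ⟨Spec.map (CommRingCat.ofHom Ψ), ?_, fun p => ?_,
    IsClosedImmersion.spec_of_surjective _ ?_⟩
  · rw [subvarietyIncl, affineSpaceStr, ← Spec.map_comp, ← Spec.map_comp, ← CommRingCat.ofHom_comp,
      ← CommRingCat.ofHom_comp, affineSpaceStr]
    congr 2
    ext r
    exact Φ.commutes r
  · rw [subvarietyIncl, point, ← Spec.map_comp, ← Spec.map_comp, ← CommRingCat.ofHom_comp,
      ← CommRingCat.ofHom_comp, point]
    congr 2
    ext F
    exact hΦ p F
  · suffices h : Φ.range = ⊤ by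
      intro G
      obtain ⟨F, rfl⟩ := (AlgHom.range_eq_top Φ).1 h G
      exact ⟨Ideal.Quotient.mk _ F, rfl⟩
    rw [eq_top_iff]
    rintro G -
    induction G using SymmetricAlgebra.induction with
    | algebraMap r => exact algebraMap_mem _ r
    | ι d =>
      obtain ⟨ξ, hξ⟩ := hd d
      refine ⟨SymmetricAlgebra.ι k _ ξ, coordRing_ext fun p => ?_⟩
      change evalAt k p (Φ _) = _
      rw [hΦ, evalAt_ι, evalAt_ι, hξ]
    | mul a b ha hb => exact mul_mem ha hb
    | add a b ha hb => exact add_mem ha hb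

end CoordRing

/-! ### Polynomial dependence of the multiplication on the form -/

section CliffordMulPolynomial

open CliffordAlgebra

variable {k : Type u} [Field k] {M : Type u} [AddCommGroup M] [Module k M]

/-- Families of elements of the Clifford algebras of all quadratic forms on `M` that are polynomial
combinations of products of vectors. -/
inductive IsPolynomialSection : (∀ q : QuadraticForm k M, CliffordAlgebra q) → Prop
  | one : IsPolynomialSection fun _ => 1
  | add {s t : ∀ q : QuadraticForm k M, CliffordAlgebra q} :
      IsPolynomialSection s → IsPolynomialSection t → IsPolynomialSection fun q => s q + t q
  | smul {c : QuadraticForm k M → k} {s : ∀ q : QuadraticForm k M, CliffordAlgebra q} :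
      IsPolynomialMap (k := k) c → IsPolynomialSection s → IsPolynomialSection fun q => c q • s q
  | ι_mul (a : M) {s : ∀ q : QuadraticForm k M, CliffordAlgebra q} :
      IsPolynomialSection s → IsPolynomialSection fun q => ι q a * s q

variable {β : QuadraticForm k M →ₗ[k] LinearMap.BilinForm k M}

theorem toQuadraticMap_eq_sub_zero (hβ : ∀ q : QuadraticForm k M, (β q).toQuadraticMap = q)
    (q : QuadraticForm k M) : (β q).toQuadraticMap = q - 0 := by
  rw [hβ, sub_zero]

namespace IsPolynomialSection

theorem const_smul (c : k) {s : ∀ q : QuadraticForm k M, CliffordAlgebra q}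
    (hs : IsPolynomialSection s) : IsPolynomialSection fun q => c • s q :=
  smul (.const c) hs

theorem sub {s t : ∀ q : QuadraticForm k M, CliffordAlgebra q} (hs : IsPolynomialSection s)
    (ht : IsPolynomialSection t) : IsPolynomialSection fun q => s q - t q := by
  simpa [sub_eq_add_neg] using hs.add (ht.const_smul (-1))

/-- Contraction satisfies `a ⌋ (b s) = β(a, b) s - b (a ⌋ s)`, and `β q a b` is linear in `q`. -/
theorem contractLeft [Module.Finite k (QuadraticForm k M)] (a : M)
    {s : ∀ q : QuadraticForm k M, CliffordAlgebra q} (hs : IsPolynomialSection s) :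
    IsPolynomialSection fun q => CliffordAlgebra.contractLeft (β q a) (s q) := by
  induction hs with
  | one => simpa using (one (k := k) (M := M)).const_smul (0 : k)
  | add _ _ hs ht => simpa only [map_add] using hs.add ht
  | smul hc _ hs => simpa only [map_smul] using hs.smul hc
  | ι_mul b hs ih =>
    simp only [contractLeft_ι_mul]
    exact (hs.smul (IsPolynomialMap.linear ((β.flip a).flip b))).sub (ih.ι_mul b)

theorem changeForm [Module.Finite k (QuadraticForm k M)]
    (hβ : ∀ q : QuadraticForm k M, (β q).toQuadraticMap = q)
    (x : CliffordAlgebra (0 : QuadraticForm k M)) :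
    IsPolynomialSection fun q =>
      CliffordAlgebra.changeForm (toQuadraticMap_eq_sub_zero hβ q) x := by
  induction x using CliffordAlgebra.left_induction with
  | algebraMap r =>
    simp only [Algebra.algebraMap_eq_smul_one, map_smul, changeForm_one]
    exact (one (k := k) (M := M)).const_smul r
  | add x y hx hy => simpa only [map_add] using hx.add hy
  | ι_mul x a hx =>
    simp only [changeForm_ι_mul]
    exact (hx.ι_mul a).sub (hx.contractLeft a)

/-- Vectors are stripped off the left factor by `λ⁻¹(a u) = a ∧ λ⁻¹ u + β(a, ·) ⌋ λ⁻¹ u`. This ends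
with `λ⁻¹(λ y) = y`, which is constant in `q`. All values lie in one fixed space, the exterior
algebra. -/
theorem isPolynomialMap_changeForm_mul [Module.Finite k (QuadraticForm k M)]
    (hβ : ∀ q : QuadraticForm k M, (β q).toQuadraticMap = q)
    {s : ∀ q : QuadraticForm k M, CliffordAlgebra q} (hs : IsPolynomialSection s)
    (y : CliffordAlgebra (0 : QuadraticForm k M)) :
    IsPolynomialMap (k := k) fun q =>
      CliffordAlgebra.changeForm (changeForm.neg_proof (toQuadraticMap_eq_sub_zero hβ q))
        (s q * CliffordAlgebra.changeForm (toQuadraticMap_eq_sub_zero hβ q) y) := by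
  induction hs with
  | one =>
    simp only [one_mul]
    have h (q : QuadraticForm k M) := (changeFormEquiv (toQuadraticMap_eq_sub_zero hβ q)).left_inv y
    exact (funext h : _ = fun _ => y) ▸ .const y
  | add _ _ hs ht => simpa only [add_mul, map_add] using hs.add ht
  | smul hc _ hs => simpa only [smul_mul_assoc, map_smul] using hc.smul hs
  | ι_mul a _ ih =>
    simp only [mul_assoc, changeForm_ι_mul, LinearMap.neg_apply, map_neg, sub_neg_eq_add]
    exact (ih.map (LinearMap.mulLeft k (ι 0 a))).add
      (ih.bilinear (CliffordAlgebra.contractLeft ∘ₗ β.flip a))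

end IsPolynomialSection

theorem finite_evenExterior (h2 : (2 : k) ≠ 0) [Module.Finite k M] :
    Module.Finite k (EvenExterior k M) :=
  have := finite_clifford h2 (0 : QuadraticForm k M)
  inferInstanceAs (Module.Finite k (evenOdd (0 : QuadraticForm k M) 0))

theorem isPolynomialMap_cliffordMul (h2 : (2 : k) ≠ 0) [Module.Finite k M]
    [Module.Finite k (QuadraticForm k M)]
    (hβ : ∀ q : QuadraticForm k M, (β q).toQuadraticMap = q) :
    IsPolynomialMap (k := k) fun q => cliffordMul q (β q) (hβ q) := by
  have := finite_evenExterior (M := M) h2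
  refine .of_apply_apply fun x y => ?_
  -- The polynomial map takes values in the full exterior algebra; a linear retraction returns it to
  -- the even part.
  obtain ⟨g, hg⟩ := even_exists_retraction (0 : QuadraticForm k M)
  have h := ((IsPolynomialSection.changeForm hβ x.1).isPolynomialMap_changeForm_mul hβ y.1).map g
  convert h using 2 with q
  exact (hg (cliffordMul q (β q) (hβ q) x y)).symm

end CliffordMulPolynomial

/-! ### Recovering the form from the structure constants -/

section Recovery

open CliffordAlgebra

variable {k : Type u} [Field k] {M : Type u} [AddCommGroup M] [Module k M]

/-- The wedge product of two vectors, as an element of the even exterior algebra. -/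
def wedge (a b : M) : EvenExterior k M := (even.ι (0 : QuadraticForm k M)).bilin a b

theorem coe_evenIso_wedge (q : QuadraticForm k M) (B : LinearMap.BilinForm k M)
    (h : B.toQuadraticMap = q) (a b : M) :
    (evenIso q B h (wedge a b) : CliffordAlgebra q) = ι q a * ι q b - algebraMap k _ (B a b) :=
  changeForm_ι_mul_ι (by rw [h, sub_zero]) a b

/-- Moving the second `a` past `b` turns `a b a c` into a multiple of `a c` minus `q(a) b c`. So `b
∧ c` has coefficient `-q a`, and every other term is a scalar or a multiple of a wedge with `a`. -/
theorem cliffordMul_wedge_wedge (q : QuadraticForm k M) (B : LinearMap.BilinForm k M)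
    (h : B.toQuadraticMap = q) (a b c : M) :
    cliffordMul q B h (wedge a b) (wedge a c) =
      B b a • wedge a c - q a • wedge b c - B a c • wedge a b +
        algebraMap k _ (B b a * B a c - q a * B b c) := by
  refine (evenIso q B h).injective (Subtype.ext ?_)
  rw [evenIso_cliffordMul]
  have hpolar : ι q b * ι q a = algebraMap k _ (B a b + B b a) - ι q a * ι q b := by
    rw [ι_mul_ι_comm, ← h, LinearMap.BilinMap.polar_toQuadraticMap, add_comm (B b a)]
  have h1 : ι q a * ι q b * (ι q a * ι q c) =
      (B a b + B b a) • (ι q a * ι q c) - q a • (ι q b * ι q c) := by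
    rw [mul_assoc, ← mul_assoc (ι q b), hpolar, sub_mul, mul_sub, ← Algebra.smul_def,
      mul_smul_comm, mul_assoc (ι q a) (ι q b), ← mul_assoc (ι q a) (ι q a), ι_sq_scalar,
      ← Algebra.smul_def]
  have halg (r : k) : (evenIso q B h (algebraMap k _ r) : CliffordAlgebra q) = algebraMap k _ r :=
    changeForm_algebraMap (by rw [h, sub_zero]) r
  simp only [map_add, map_sub, map_smul, Subalgebra.coe_add, Subalgebra.coe_sub, Subalgebra.coe_mul,
    Subalgebra.coe_smul, coe_evenIso_wedge, halg]
  rw [sub_mul, mul_sub, mul_sub, h1]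
  simp only [Algebra.algebraMap_eq_smul_one, smul_mul_assoc, mul_smul_comm, one_mul, mul_one]
  module

/-- The functional on the even exterior algebra given by contraction with `d` and `d'`. -/
def contractTwo (d d' : Module.Dual k M) : Module.Dual k (EvenExterior k M) :=
  ExteriorAlgebra.algebraMapInv.toLinearMap ∘ₗ contractLeft d' ∘ₗ contractLeft d ∘ₗ
    (even (0 : QuadraticForm k M)).val.toLinearMap

theorem contractTwo_wedge (d d' : Module.Dual k M) (a b : M) :
    contractTwo d d' (wedge a b) = d a * d' b - d b * d' a := by
  have h : contractLeft d' (contractLeft d (ι (0 : QuadraticForm k M) a * ι 0 b)) =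
      algebraMap k _ (d a * d' b - d b * d' a) := by
    rw [contractLeft_ι_mul, contractLeft_ι, map_sub, map_smul, contractLeft_ι,
      contractLeft_mul_algebraMap, contractLeft_ι, Algebra.smul_def, ← map_mul, ← map_mul,
      ← map_sub, mul_comm (d' a)]
  change ExteriorAlgebra.algebraMapInv (contractLeft d' (contractLeft d (ι 0 a * ι 0 b))) = _
  rw [h]
  exact ExteriorAlgebra.algebraMap_leftInverse M _

theorem contractTwo_algebraMap (d d' : Module.Dual k M) (r : k) :
    contractTwo d d' (algebraMap k _ r) = 0 := by
  change ExteriorAlgebra.algebraMapInv (contractLeft d' (contractLeft d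
    (algebraMap k (CliffordAlgebra (0 : QuadraticForm k M)) r))) = _
  simp

/-- Three members of a basis containing `a` do this. Contracting with `d` and `d'` then kills all
wedges with `a` and sends `b ∧ c` to `1`. -/
theorem exists_dual_pair (hM : 3 ≤ Module.finrank k M) {a : M} (ha : a ≠ 0) :
    ∃ (b c : M) (d d' : Module.Dual k M), d a = 0 ∧ d' a = 0 ∧ d b = 1 ∧ d' c = 1 ∧ d c = 0 := by
  classical
  have : Module.Finite k M := Module.finite_of_finrank_pos (by omega)
  have hs : LinearIndepOn k id {a} := LinearIndepOn.singleton ha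
  let e := Module.Basis.extend hs
  let i : hs.extend (Set.subset_univ _) := ⟨a, hs.subset_extend _ rfl⟩
  have hi : e i = a := Module.Basis.extend_apply_self hs i
  have : Fintype (hs.extend (Set.subset_univ _)) := FiniteDimensional.fintypeBasisIndex e
  rw [Module.finrank_eq_card_basis e, ← Finset.card_univ] at hM
  obtain ⟨j, -, hj⟩ := Finset.exists_mem_notMem_of_card_lt_card (s := {i}) (t := Finset.univ)
    (by rw [Finset.card_singleton]; omega)
  obtain ⟨l, -, hl⟩ := Finset.exists_mem_notMem_of_card_lt_card (s := {i, j}) (t := Finset.univ)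
    (by have := Finset.card_le_two (a := i) (b := j); omega)
  simp only [Finset.mem_insert, Finset.mem_singleton, not_or] at hj hl
  refine ⟨e j, e l, e.coord j, e.coord l, ?_, ?_, ?_, ?_, ?_⟩ <;>
    simp [← hi, Ne.symm hj, Ne.symm hl.1, hl.2]

/-- The values of a quadratic form are linear functions of the structure constants of its even
Clifford algebra. -/
theorem exists_dual_cliffordMul_eq_apply (hM : 3 ≤ Module.finrank k M) (a : M) :
    ∃ ξ : Module.Dual k (EvenExterior k M →ₗ[k] EvenExterior k M →ₗ[k] EvenExterior k M),
      ∀ (q : QuadraticForm k M) (B : LinearMap.BilinForm k M) (h : B.toQuadraticMap = q),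
        ξ (cliffordMul q B h) = q a := by
  rcases eq_or_ne a 0 with rfl | ha
  · exact ⟨0, fun q B h => by simp⟩
  obtain ⟨b, c, d, d', h1, h2, h3, h4, h5⟩ := exists_dual_pair hM ha
  refine ⟨-(contractTwo d d' ∘ₗ LinearMap.applyₗ (wedge a c) ∘ₗ LinearMap.applyₗ (wedge a b)),
    fun q B h => ?_⟩
  change -contractTwo d d' (cliffordMul q B h (wedge a b) (wedge a c)) = q a
  rw [cliffordMul_wedge_wedge, map_add, contractTwo_algebraMap]
  simp [contractTwo_wedge, h1, h2, h3, h4, h5]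

theorem exists_dual_cliffordMul_eq [Module.Finite k (QuadraticForm k M)]
    (hM : 3 ≤ Module.finrank k M) (β : QuadraticForm k M →ₗ[k] LinearMap.BilinForm k M)
    (hβ : ∀ q : QuadraticForm k M, (β q).toQuadraticMap = q)
    (d : Module.Dual k (QuadraticForm k M)) :
    ∃ ξ : Module.Dual k (EvenExterior k M →ₗ[k] EvenExterior k M →ₗ[k] EvenExterior k M),
      ∀ q, ξ (cliffordMul q (β q) (hβ q)) = d q := by
  let D : Submodule k (Module.Dual k (QuadraticForm k M)) :=
    { carrier := {d | ∃ ξ : Module.Dual k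
        (EvenExterior k M →ₗ[k] EvenExterior k M →ₗ[k] EvenExterior k M),
        ∀ q, ξ (cliffordMul q (β q) (hβ q)) = d q}
      zero_mem' := ⟨0, fun q => rfl⟩
      add_mem' := fun ⟨ξ, hξ⟩ ⟨η, hη⟩ => ⟨ξ + η, fun q => by simp [hξ, hη]⟩
      smul_mem' := fun c _ ⟨ξ, hξ⟩ => ⟨c • ξ, fun q => by simp [hξ]⟩ }
  suffices h : D = ⊤ from (h ▸ Submodule.mem_top : d ∈ D)
  -- A form killed by all evaluations `q ↦ q a` is zero. In finite dimension a space of functionals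
  -- without common zeros is the whole dual.
  have hD : D.dualCoannihilator = ⊥ := by
    rw [eq_bot_iff]
    intro q hq
    rw [Submodule.mem_dualCoannihilator] at hq
    ext a
    obtain ⟨ξ, hξ⟩ := exists_dual_cliffordMul_eq_apply hM a
    exact hq
      { toFun := fun q => q a, map_add' := fun _ _ => rfl, map_smul' := fun _ _ => rfl }
      ⟨ξ, fun q => hξ q _ (hβ q)⟩
  rw [← Subspace.dualCoannihilator_dualAnnihilator_eq (W := D), hD, Submodule.dualAnnihilator_bot]

end Recovery

theorem finite_quadraticForm {k : Type u} [Field k] {M : Type u} [AddCommGroup M] [Module k M]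
    [Module.Finite k M] (β : QuadraticForm k M →ₗ[k] LinearMap.BilinForm k M)
    (hβ : ∀ q : QuadraticForm k M, (β q).toQuadraticMap = q) :
    Module.Finite k (QuadraticForm k M) :=
  Module.Finite.of_injective β fun q q' h => by rw [← hβ q, h, hβ q']

end

end CliffordSpecialisation

open CliffordSpecialisation in
/-- Let `k` be algebraically closed with `2 ≠ 0`, let `dim M = 2 ℓ + 1` with `ℓ ≥ 1`, and let
`n = 2 ^ ℓ`. Identify all even Clifford algebras `Cl⁺(q)` with the even exterior algebra of `M`
through bilinear forms `β q` with `β q x x = q x` that depend linearly on `q` (this covers both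
antisymmetrisation and the ordered monomials in a basis of `M`). Then every `Cl⁺(q)` is a
specialisation of the algebra of `n × n` matrices, and `q ↦ Cl⁺(q)` is (on `k`-rational points) a
morphism of `k`-schemes from the affine space of quadratic forms to `𝒜ₙ` which is a closed
immersion. -/
theorem proposition3p1 {k : Type u} [Field k] [IsAlgClosed k] (h2 : (2 : k) ≠ 0)
    {M : Type u} [AddCommGroup M] [Module k M] (ℓ : ℕ) (hℓ : 1 ≤ ℓ)
    (hM : Module.finrank k M = 2 * ℓ + 1)
    (β : QuadraticForm k M →ₗ[k] LinearMap.BilinForm k M)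
    (hβ : ∀ q : QuadraticForm k M, (β q).toQuadraticMap = q) :
    (∀ q : QuadraticForm k M,
      cliffordMul q (β q) (hβ q) ∈ specialisations k (2 ^ ℓ) (1 : EvenExterior k M)) ∧
    ∃ θ : affineSpace k (QuadraticForm k M) ⟶
        specialisationVariety k (2 ^ ℓ) (1 : EvenExterior k M),
      θ ≫ subvarietyIncl k _ ≫ affineSpaceStr k _ = affineSpaceStr k _ ∧
      (∀ q : QuadraticForm k M,
        point k q ≫ θ ≫ subvarietyIncl k _ = point k (cliffordMul q (β q) (hβ q))) ∧
      IsClosedImmersion θ := by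
  have : Module.Finite k M := Module.finite_of_finrank_pos (by omega)
  have := finite_quadraticForm β hβ
  have hS (q) := cliffordMul_mem_specialisations h2 hM q (β q) (hβ q)
  exact ⟨hS, (isPolynomialMap_cliffordMul h2 hβ).exists_isClosedImmersion hS
    (exists_dual_cliffordMul_eq (by omega) β hβ)⟩
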